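/- Let $\mathbf{x}=(x_i)_{i\in\iota}$ be finitely many real variables and $\mathbf{b}$ finitely many Boolean variables. Let $\theta(\mathbf{x},\mathbf{b})$ be an SMT($\mathcal{LRA}$) theory in conjunctive normal form: a finite conjunction of clauses, each a finite disjunction of literals, where a literal is an atom or its negation, and an atom is a Boolean variable, a linear constraint $s\bowtie t$, or a chained linear constraint $s\bowtie t\bowtie' u$, with $s,t,u$ affine terms in $\mathbf{x}$ and $\bowtie,\bowtie'\in\{<,\le,=\}$. The primal graph of $\theta$ has all real and Boolean variables as vertices, and two distinct variables are adjacent iff they occur in a common clause. Assume that it is a tree or, more generally, has no cycles. Let $\mathcal L$ be a finite set of literals over these variables, let $p_\ell\in\mathbb R[\mathbf{x}]$ be a polynomial for each $\ell\in\mathcal L$, and let $$w(\mathbf{x},\mathbf{b})=\prod_{\ell\in\mathcal L,\ (\mathbf{x},\mathbf{b})\models \ell}p_\ell(\mathbf{x}).$$ Assume that the weighted model integral is well defined, that is, for every truth assignment $\mathbf{b}^*$ the function $w(\cdot,\mathbf{b}^*)$ is Lebesgue integrable on the solution set $\{\mathbf{x}\mid\theta(\mathbf{x},\mathbf{b}^*)\}$,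 and put $$\mathrm{WMI}(\theta,w)=\sum_{\mathbf{b}^*}\int_{\{\mathbf{x}\,\mid\,\theta(\mathbf{x},\mathbf{b}^*)\}}w(\mathbf{x},\mathbf{b}^*)\,d\mathbf{x}.$$ Let $y$ be any of the real variables, let $\hat{\mathbf{x}}$ be the remaining real variables, and let $$p(y^*)=\sum_{\mathbf{b}^*}\int_{\{\hat{\mathbf{x}}\,\mid\,\theta(y^*,\hat{\mathbf{x}},\mathbf{b}^*)\}}w(y^*,\hat{\mathbf{x}},\mathbf{b}^*)\,d\hat{\mathbf{x}},\qquad I=\{y^*\in\mathbb R\mid\exists\,\hat{\mathbf{x}}^*\,\exists\,\mathbf{b}^*:\ \theta(y^*,\hat{\mathbf{x}}^*,\mathbf{b}^*)\},$$ where an integral that does not converge absolutely is given the value $0$ (and if there are no remaining real variables, the integral is evaluation at the single point of $\mathbb R^0$). Then: 1. for all but finitely many $y^*\in\mathbb R$, all the integrals that define $p(y^*)$ converge absolutely; 2. $p$ is a univariate piecewise polynomial on $I$: the set $I$ is the union of finitely many pairwise disjoint intervals (open, closed, half-open, one-point or unbounded), on each of which $p$ agrees with a polynomial; 3. $p$ is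 integrable on $I$, and $$\mathrm{WMI}(\theta,w)=\int_I p(y)\,dy.$$ -/

import Mathlib

noncomputable section

namespace SMTLRA

open MeasureTheory

/-- An affine term `∑ i, coeff i * x i + const` over the real variables indexed by `ι`. -/
structure LinTerm (ι : Type*) where
  coeff : ι → ℝ
  const : ℝ

/-- The comparison symbols. The symbols `>` and `≥` are obtained by exchanging the two sides, and
`≠` by negating a literal. -/
inductive Cmp where
  | lt
  | le
  | eq

/-- Atoms: propositional variables, linear constraints `s ⋈ t`, and chained linear
constraints `s ⋈₁ t ⋈₂ u` such as `0 < x < 3000`. -/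
inductive Atom (ι κ : Type*) where
  | bool (a : κ)
  | cmp (r : Cmp) (s t : LinTerm ι)
  | chain (r₁ r₂ : Cmp) (s t u : LinTerm ι)

/-- A literal is an atom or a negated atom. -/
inductive Literal (ι κ : Type*) where
  | pos (A : Atom ι κ)
  | neg (A : Atom ι κ)

/-- A clause is a finite disjunction of literals. -/
abbrev Clause (ι κ : Type*) := List (Literal ι κ)

/-- A theory in conjunctive normal form: a finite conjunction of clauses. -/
abbrev CNF (ι κ : Type*) := List (Clause ι κ)

section semantics

variable {ι κ : Type*} [Fintype ι]

def LinTerm.eval (t : LinTerm ι) (x : ι → ℝ) : ℝ := ∑ i, t.coeff i * x i + t.const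

def Cmp.Holds : Cmp → ℝ → ℝ → Prop
  | .lt, a, c => a < c
  | .le, a, c => a ≤ c
  | .eq, a, c => a = c

def Atom.Holds (x : ι → ℝ) (b : κ → Bool) : Atom ι κ → Prop
  | .bool a => b a = true
  | .cmp r s t => r.Holds (s.eval x) (t.eval x)
  | .chain r₁ r₂ s t u => r₁.Holds (s.eval x) (t.eval x) ∧ r₂.Holds (t.eval x) (u.eval x)

def Literal.Holds (x : ι → ℝ) (b : κ → Bool) : Literal ι κ → Prop
  | .pos A => A.Holds x b
  | .neg A => ¬ A.Holds x b

/-- `θ(x, b)` is true. -/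
def CNF.Holds (θ : CNF ι κ) (x : ι → ℝ) (b : κ → Bool) : Prop :=
  ∀ C ∈ θ, ∃ l ∈ C, l.Holds x b

/-- The set of real solutions of the theory under the truth assignment `b`. -/
def CNF.solutions (θ : CNF ι κ) (b : κ → Bool) : Set (ι → ℝ) := {x | θ.Holds x b}

end semantics

section graph

variable {ι κ : Type*}

/-- The real variables that occur in a term, as elements of the set of all variables `ι ⊕ κ`. -/
def LinTerm.vars (κ : Type*) (t : LinTerm ι) : Set (ι ⊕ κ) := {v | ∃ i, v = .inl i ∧ t.coeff i ≠ 0}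

def Atom.vars : Atom ι κ → Set (ι ⊕ κ)
  | .bool a => {.inr a}
  | .cmp _ s t => s.vars κ ∪ t.vars κ
  | .chain _ _ s t u => s.vars κ ∪ t.vars κ ∪ u.vars κ

def Literal.vars : Literal ι κ → Set (ι ⊕ κ)
  | .pos A => A.vars
  | .neg A => A.vars

def Clause.vars (C : Clause ι κ) : Set (ι ⊕ κ) := {v | ∃ l ∈ C, v ∈ l.vars}

/-- The primal graph: the vertices are all real and Boolean variables, and two distinct variables
are adjacent when they occur in a common clause. -/
def CNF.primalGraph (θ : CNF ι κ) : SimpleGraph (ι ⊕ κ) where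
  Adj u v := u ≠ v ∧ ∃ C ∈ θ, u ∈ Clause.vars C ∧ v ∈ Clause.vars C
  symm := ⟨fun _ _ ⟨h, C, hC, hu, hv⟩ => ⟨h.symm, C, hC, hv, hu⟩⟩
  loopless := ⟨fun _ h => h.1 rfl⟩

end graph

section wmi

variable {ι κ : Type*} [Fintype ι]

open Classical in
/-- The weight `w(x, b) = ∏_{l ∈ L, (x, b) ⊨ l} P l (x)` given by polynomial per-literal weights. -/
def weight (L : Finset (Literal ι κ)) (P : Literal ι κ → MvPolynomial ι ℝ)
    (x : ι → ℝ) (b : κ → Bool) : ℝ :=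
  ∏ l ∈ L with l.Holds x b, MvPolynomial.eval x (P l)

/-- Weighted model integration `∑_b ∫_{θ(x, b)} w(x, b) dx`. -/
def WMI [Fintype κ] [DecidableEq κ] (θ : CNF ι κ) (w : (ι → ℝ) → (κ → Bool) → ℝ) : ℝ :=
  ∑ b : κ → Bool, ∫ x in θ.solutions b, w x b

variable [DecidableEq ι]

/-- The assignment to all real variables that takes the value `t` at `y` and is `z` at the remaining
variables. -/
def glue (y : ι) (t : ℝ) (z : {i : ι // i ≠ y} → ℝ) : ι → ℝ :=
  fun i => if h : i = y then t else z ⟨i, h⟩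

/-- The set of solutions in the remaining variables when `y` is fixed to `t`. -/
def CNF.fiber (θ : CNF ι κ) (y : ι) (t : ℝ) (b : κ → Bool) : Set ({i : ι // i ≠ y} → ℝ) :=
  {z | θ.Holds (glue y t z) b}

/-- The density `p(t) = ∑_b ∫_{θ(t, z, b)} w(t, z, b) dz` of the WMI at `y = t`. -/
def fiberIntegral [Fintype κ] [DecidableEq κ] (θ : CNF ι κ) (w : (ι → ℝ) → (κ → Bool) → ℝ)
    (y : ι) (t : ℝ) : ℝ :=
  ∑ b : κ → Bool, ∫ z in θ.fiber y t b, w (glue y t z) b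

/-- The projection of the solution set of the theory onto the variable `y`. -/
def CNF.projection (θ : CNF ι κ) (y : ι) : Set ℝ :=
  {t | ∃ (z : {i : ι // i ≠ y} → ℝ) (b : κ → Bool), θ.Holds (glue y t z) b}

end wmi

/-- `I` is the union of finitely many pairwise disjoint intervals (open, closed, half-open,
one-point or unbounded), on each of which `p` agrees with a polynomial. -/
def IsPiecewisePolynomialOn (p : ℝ → ℝ) (I : Set ℝ) : Prop :=
  ∃ (k : ℕ) (J : Fin k → Set ℝ) (q : Fin k → Polynomial ℝ),
    (∀ i, (J i).OrdConnected) ∧ Pairwise (fun i j => Disjoint (J i) (J j)) ∧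
    (⋃ i, J i) = I ∧ ∀ i, ∀ t ∈ J i, p t = (q i).eval t

end SMTLRA

end

/-!
The signs of the finitely many affine functions `s - t`, one for each comparison in the theory or in
a weighted literal, divide `ℝ^ι` into polyhedral cells. For a fixed truth assignment `b` the truth
of every literal is constant on a cell, so the weight, extended by zero off the solutions, is a
polynomial function on each cell. It therefore suffices to study integrable functions that are
polynomial on the cells of an arrangement (`exists_finite_fiber_of_cellwise`), cell by cell
(`exists_finite_fiber_signCell`):

* If a nonzero affine function vanishes on the cell, then the fibres of the cell over `y = t` are
  null, except for the single `t` for which the zero set may contain the whole hyperplane `y = t`.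
* Otherwise the cell is open. If it is unbounded, it is invariant under translation along some ray.
  A polynomial integrable over it is summable along the integer points of almost every parallel ray,
  so it vanishes (`eq_zero_of_integrableOn_unbounded`), and the cell contributes nothing.
* If the cell is open and bounded, every fibre is bounded and the integrals converge. The variables
  other than `y` are integrated out one at a time. The fibre of a polyhedral set in one variable is
  an interval from the largest of some affine lower bounds to the smallest of some affine upper
  bounds. Which bounds are extremal is again decided by affine inequalities, and substituting them
  in a polynomial antiderivative gives a polynomial (`integral_indicator_mem_piecewisePoly`). So
  piecewise polynomial functions with polyhedral pieces are preserved, and in the single variable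
  `y` the polyhedral pieces are intervals.

The projection of the solution set to `y` is a finite union of projections of convex cells, that is
of intervals. The finitely many exceptional values of `t` become one-point pieces. The integral
formula is Fubini's theorem, as the density vanishes off the projection.
-/

noncomputable section

open MeasureTheory

namespace SMTLRA

/-! ### Polynomial functions and polyhedral sets -/

section Polyhedral

variable {V W : Type*} [AddCommGroup V] [Module ℝ V] [AddCommGroup W] [Module ℝ W]

/-- The polynomial functions on a real vector space: the algebra of functions generated by the
affine ones. -/
def polyFun (V : Type*) [AddCommGroup V] [Module ℝ V] : Subalgebra ℝ (V → ℝ) :=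
  Algebra.adjoin ℝ (Set.range fun (g : V →ᵃ[ℝ] ℝ) => (g : V → ℝ))

lemma affine_mem_polyFun (g : V →ᵃ[ℝ] ℝ) : (g : V → ℝ) ∈ polyFun V :=
  Algebra.subset_adjoin ⟨g, rfl⟩

lemma comp_mem_polyFun {r : W → ℝ} (hr : r ∈ polyFun W) (φ : V →ᵃ[ℝ] W) :
    r ∘ φ ∈ polyFun V := by
  induction hr using Algebra.adjoin_induction with
  | mem f hf => obtain ⟨g, rfl⟩ := hf; exact affine_mem_polyFun (g.comp φ)
  | algebraMap c => exact (polyFun V).algebraMap_mem c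
  | add f g _ _ hf hg => exact add_mem hf hg
  | mul f g _ _ hf hg => exact mul_mem hf hg

lemma eval_mem_polyFun {ι : Type*} (q : MvPolynomial ι ℝ) :
    (fun x : ι → ℝ => MvPolynomial.eval x q) ∈ polyFun (ι → ℝ) := by
  induction q using MvPolynomial.induction_on with
  | C a =>
    simp only [MvPolynomial.eval_C]
    exact (polyFun (ι → ℝ)).algebraMap_mem a
  | add p q hp hq =>
    simp only [map_add]
    exact add_mem hp hq
  | mul_X p i hp =>
    simp only [map_mul, MvPolynomial.eval_X]
    exact mul_mem hp
      (affine_mem_polyFun (LinearMap.proj (R := ℝ) (φ := fun _ : ι => ℝ) i).toAffineMap)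

lemma exists_polynomial_of_mem_polyFun {r : ℝ → ℝ} (hr : r ∈ polyFun ℝ) :
    ∃ q : Polynomial ℝ, ∀ t, r t = q.eval t := by
  induction hr using Algebra.adjoin_induction with
  | mem f hf =>
    obtain ⟨g, rfl⟩ := hf
    refine ⟨Polynomial.C (g.linear 1) * Polynomial.X + Polynomial.C (g 0), fun t => ?_⟩
    have h1 := congrFun g.decomp t
    have h2 : g.linear t = t * g.linear 1 := by
      simpa using g.linear.map_smul t 1
    simp only [Pi.add_apply, h2] at h1
    change g t = _
    rw [h1, Polynomial.eval_add, Polynomial.eval_mul, Polynomial.eval_C, Polynomial.eval_X,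
      Polynomial.eval_C, mul_comm]
  | algebraMap c => exact ⟨Polynomial.C c, fun t => by simp⟩
  | add f g _ _ hf hg =>
    obtain ⟨p, hp⟩ := hf
    obtain ⟨q, hq⟩ := hg
    exact ⟨p + q, fun t => by simp [hp, hq]⟩
  | mul f g _ _ hf hg =>
    obtain ⟨p, hp⟩ := hf
    obtain ⟨q, hq⟩ := hg
    exact ⟨p * q, fun t => by simp [hp, hq]⟩

lemma continuous_of_mem_polyFun {E : Type*} [NormedAddCommGroup E] [NormedSpace ℝ E]
    [FiniteDimensional ℝ E] {r : E → ℝ} (hr : r ∈ polyFun E) : Continuous r := by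
  induction hr using Algebra.adjoin_induction with
  | mem f hf => obtain ⟨g, rfl⟩ := hf; exact g.continuous_of_finiteDimensional
  | algebraMap c => exact continuous_const
  | add f g _ _ hf hg => exact hf.add hg
  | mul f g _ _ hf hg => exact hf.mul hg

/-- The affine map `x ↦ (x, b x)`, whose image is the graph of `b`. -/
def graphMap (b : V →ᵃ[ℝ] W) : V →ᵃ[ℝ] V × W := (AffineMap.id ℝ V).prod b

@[simp] lemma graphMap_apply (b : V →ᵃ[ℝ] W) (x : V) : graphMap b x = (x, b x) := rfl

/-- The inclusion `z ↦ (x, z)` of a fibre. -/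
def fiberMap (x : V) : W →ᵃ[ℝ] V × W := (AffineMap.const ℝ W x).prod (AffineMap.id ℝ W)

@[simp] lemma fiberMap_apply (x : V) (z : W) : fiberMap x z = (x, z) := rfl

lemma affine_apply_prod (g : V × ℝ →ᵃ[ℝ] ℝ) (x : V) (s : ℝ) :
    g (x, s) = g (x, 0) + s * g.linear (0, 1) := by
  have h1 := g.map_vadd (x, 0) (0, s)
  have h2 : g.linear (0, s) = s * g.linear (0, 1) := by
    simpa using g.linear.map_smul s (0, 1)
  rw [h2] at h1
  simp only [vadd_eq_add, Prod.mk_add_mk, zero_add, add_zero] at h1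
  rw [h1, add_comm]

/-- A polynomial function on `V × ℝ` has an antiderivative in the last variable that is a polynomial
function as well. -/
lemma exists_antideriv {r : V × ℝ → ℝ} (hr : r ∈ polyFun (V × ℝ)) :
    ∃ F ∈ polyFun (V × ℝ), ∀ x s, HasDerivAt (fun s => F (x, s)) (r (x, s)) s := by
  -- `Φ` expands polynomials in `s` whose coefficients are polynomial functions of `x`.
  let pull : polyFun V →+* (V × ℝ → ℝ) :=
    { toFun := fun c p => (c : V → ℝ) p.1
      map_one' := rfl
      map_mul' := fun _ _ => rfl
      map_zero' := rfl
      map_add' := fun _ _ => rfl }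
  let Φ : Polynomial (polyFun V) →+* (V × ℝ → ℝ) :=
    Polynomial.eval₂RingHom pull (fun p : V × ℝ => p.2)
  have hΦ : ∀ k (c : polyFun V) (x : V) (s : ℝ),
      Φ (Polynomial.monomial k c) (x, s) = (c : V → ℝ) x * s ^ k := by
    intro k c x s
    simp only [Φ, Polynomial.coe_eval₂RingHom, Polynomial.eval₂_monomial]
    rfl
  have hrange : ∃ p, Φ p = r := by
    induction hr using Algebra.adjoin_induction with
    | mem f hf =>
      obtain ⟨g, rfl⟩ := hf
      refine ⟨Polynomial.monomial 0
        ⟨g ∘ graphMap (AffineMap.const ℝ V 0), comp_mem_polyFun (affine_mem_polyFun g) _⟩ +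
        Polynomial.monomial 1 (algebraMap ℝ _ (g.linear (0, 1))), ?_⟩
      funext ⟨x, s⟩
      rw [map_add, Pi.add_apply, hΦ, hΦ]
      change g (x, 0) * s ^ 0 + g.linear (0, 1) * s ^ 1 = g (x, s)
      rw [affine_apply_prod g x s]
      ring
    | algebraMap c =>
      refine ⟨Polynomial.monomial 0 (algebraMap ℝ _ c), ?_⟩
      funext ⟨x, s⟩
      rw [hΦ, pow_zero, mul_one]
      rfl
    | add f g _ _ hf hg =>
      obtain ⟨p, rfl⟩ := hf
      obtain ⟨q, rfl⟩ := hg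
      exact ⟨p + q, map_add Φ p q⟩
    | mul f g _ _ hf hg =>
      obtain ⟨p, rfl⟩ := hf
      obtain ⟨q, rfl⟩ := hg
      exact ⟨p * q, map_mul Φ p q⟩
  obtain ⟨p, rfl⟩ := hrange
  clear hr
  have hfst : ∀ c : polyFun V, (fun p : V × ℝ => (c : V → ℝ) p.1) ∈ polyFun (V × ℝ) := fun c =>
    comp_mem_polyFun c.2 (LinearMap.fst ℝ V ℝ).toAffineMap
  have hsnd : (fun p : V × ℝ => p.2) ∈ polyFun (V × ℝ) :=
    affine_mem_polyFun (LinearMap.snd ℝ V ℝ).toAffineMap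
  induction p using Polynomial.induction_on' with
  | add p q hp hq =>
    obtain ⟨F, hF, hF'⟩ := hp
    obtain ⟨G, hG, hG'⟩ := hq
    refine ⟨F + G, add_mem hF hG, fun x s => ?_⟩
    rw [map_add]
    exact (hF' x s).add (hG' x s)
  | monomial k c =>
    refine ⟨((k : ℝ) + 1)⁻¹ • ((fun p : V × ℝ => (c : V → ℝ) p.1) * (fun p => p.2) ^ (k + 1)),
      (polyFun _).smul_mem (mul_mem (hfst c) (pow_mem hsnd _)) _, fun x s => ?_⟩
    rw [hΦ]
    have h := ((hasDerivAt_pow (k + 1) s).const_mul ((c : V → ℝ) x)).const_mul ((k : ℝ) + 1)⁻¹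
    have hk : (k : ℝ) + 1 ≠ 0 := by positivity
    refine h.congr_deriv ?_
    rw [Nat.add_sub_cancel]
    push_cast
    field_simp

/-- A polyhedral set: the solutions of finitely many strict and weak affine inequalities. -/
def IsPolyhedral (S : Set V) : Prop :=
  ∃ A B : Set (V →ᵃ[ℝ] ℝ), A.Finite ∧ B.Finite ∧
    S = {x | (∀ g ∈ A, 0 < g x) ∧ ∀ g ∈ B, 0 ≤ g x}

lemma isPolyhedral_pos (g : V →ᵃ[ℝ] ℝ) : IsPolyhedral {x | 0 < g x} :=
  ⟨{g}, ∅, Set.finite_singleton _, Set.finite_empty, by simp⟩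

lemma isPolyhedral_nonneg (g : V →ᵃ[ℝ] ℝ) : IsPolyhedral {x | 0 ≤ g x} :=
  ⟨∅, {g}, Set.finite_empty, Set.finite_singleton _, by simp⟩

lemma isPolyhedral_lt (g h : V →ᵃ[ℝ] ℝ) : IsPolyhedral {x | g x < h x} := by
  simpa using isPolyhedral_pos (h - g)

lemma isPolyhedral_le (g h : V →ᵃ[ℝ] ℝ) : IsPolyhedral {x | g x ≤ h x} := by
  simpa using isPolyhedral_nonneg (h - g)

lemma IsPolyhedral.inter {S T : Set V} (hS : IsPolyhedral S) (hT : IsPolyhedral T) :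
    IsPolyhedral (S ∩ T) := by
  obtain ⟨A, B, hA, hB, rfl⟩ := hS
  obtain ⟨A', B', hA', hB', rfl⟩ := hT
  refine ⟨A ∪ A', B ∪ B', hA.union hA', hB.union hB', ?_⟩
  ext x
  simp only [Set.mem_inter_iff, Set.mem_ofPred_eq, Set.mem_union]
  grind

lemma IsPolyhedral.iInter {α : Type*} [Finite α] {S : α → Set V} (hS : ∀ i, IsPolyhedral (S i)) :
    IsPolyhedral (⋂ i, S i) := by
  choose A B hA hB h using hS
  refine ⟨⋃ i, A i, ⋃ i, B i, Set.finite_iUnion hA, Set.finite_iUnion hB, ?_⟩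
  ext x
  simp only [h, Set.mem_iInter, Set.mem_ofPred_eq, Set.mem_iUnion]
  grind

lemma IsPolyhedral.preimage {S : Set W} (hS : IsPolyhedral S) (φ : V →ᵃ[ℝ] W) :
    IsPolyhedral (φ ⁻¹' S) := by
  obtain ⟨A, B, hA, hB, rfl⟩ := hS
  refine ⟨(fun g => g.comp φ) '' A, (fun g => g.comp φ) '' B, hA.image _, hB.image _, ?_⟩
  ext x
  simp

lemma isPolyhedral_sign (g : V →ᵃ[ℝ] ℝ) (s : SignType) :
    IsPolyhedral {x | SignType.sign (g x) = s} := by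
  rcases s with _ | _ | _
  · have : {x | SignType.sign (g x) = SignType.zero} = {x | 0 ≤ g x} ∩ {x | 0 ≤ (-g) x} := by
      ext x
      have h0 : SignType.zero = 0 := rfl
      simp only [h0, sign_eq_zero_iff, Set.mem_ofPred_eq, Set.mem_inter_iff, AffineMap.coe_neg,
        Pi.neg_apply]
      grind
    rw [this]
    exact (isPolyhedral_nonneg g).inter (isPolyhedral_nonneg (-g))
  · have : {x | SignType.sign (g x) = SignType.neg} = {x | 0 < (-g) x} := by
      ext x
      simp [sign_eq_neg_one_iff]
    rw [this]
    exact isPolyhedral_pos (-g)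
  · have : {x | SignType.sign (g x) = SignType.pos} = {x | 0 < g x} := by
      ext x
      simp [sign_eq_one_iff]
    rw [this]
    exact isPolyhedral_pos g

lemma IsPolyhedral.convex {S : Set V} (hS : IsPolyhedral S) : Convex ℝ S := by
  obtain ⟨A, B, -, -, rfl⟩ := hS
  have : {x | (∀ g ∈ A, 0 < g x) ∧ ∀ g ∈ B, 0 ≤ g x} =
      (⋂ g ∈ A, g ⁻¹' Set.Ioi 0) ∩ ⋂ g ∈ B, g ⁻¹' Set.Ici (0 : ℝ) := by
    ext x
    simp
  rw [this]
  exact (convex_iInter₂ fun g _ => (convex_Ioi 0).affine_preimage g).inter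
    (convex_iInter₂ fun g _ => (convex_Ici 0).affine_preimage g)

lemma IsPolyhedral.measurableSet {E : Type*} [NormedAddCommGroup E] [NormedSpace ℝ E]
    [FiniteDimensional ℝ E] [MeasurableSpace E] [BorelSpace E] {S : Set E} (hS : IsPolyhedral S) :
    MeasurableSet S := by
  obtain ⟨A, B, hA, hB, rfl⟩ := hS
  have : {x | (∀ g ∈ A, 0 < g x) ∧ ∀ g ∈ B, 0 ≤ g x} =
      (⋂ g ∈ A, g ⁻¹' Set.Ioi 0) ∩ ⋂ g ∈ B, g ⁻¹' Set.Ici (0 : ℝ) := by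
    ext x
    simp
  rw [this]
  refine (MeasurableSet.biInter hA.countable fun g _ => ?_).inter
    (MeasurableSet.biInter hB.countable fun g _ => ?_)
  · exact measurableSet_Ioi.preimage g.continuous_of_finiteDimensional.measurable
  · exact measurableSet_Ici.preimage g.continuous_of_finiteDimensional.measurable

/-- The functions on `V` that are piecewise polynomial with polyhedral pieces contained in `T`, and
zero off the pieces. They are encoded as sums of polynomial functions on single pieces, extended by
zero, where the pieces of different summands may overlap. -/
def piecewisePoly (T : Set V) : Submodule ℝ (V → ℝ) :=
  Submodule.span ℝ {f | ∃ S r, IsPolyhedral S ∧ S ⊆ T ∧ r ∈ polyFun V ∧ f = S.indicator r}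

lemma indicator_mem_piecewisePoly {S T : Set V} (hS : IsPolyhedral S) (h : S ⊆ T) {r : V → ℝ}
    (hr : r ∈ polyFun V) : S.indicator r ∈ piecewisePoly T :=
  Submodule.subset_span ⟨S, r, hS, h, hr, rfl⟩

lemma piecewisePoly_mono {S T : Set V} (h : S ⊆ T) :
    piecewisePoly S ≤ piecewisePoly T :=
  Submodule.span_mono fun _ ⟨A, r, hA, hAS, hr⟩ => ⟨A, r, hA, hAS.trans h, hr⟩

end Polyhedral

/-! ### Integrating out variables over polyhedral sets -/

section Elimination

universe u

variable {V : Type u} [AddCommGroup V] [Module ℝ V]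

/-- Finitely many affine functions have a piecewise affine maximum: there is a partition into
polyhedral sets `D i` on which the `i`-th function is maximal. -/
lemma exists_selector {α : Type*} [Finite α] [Nonempty α] (a : α → V →ᵃ[ℝ] ℝ) :
    ∃ D : α → Set V, (∀ i, IsPolyhedral (D i)) ∧ (∀ x, ∃ i, x ∈ D i) ∧
      (∀ x i j, x ∈ D i → x ∈ D j → i = j) ∧ ∀ i x, x ∈ D i → ∀ j, a j x ≤ a i x := by
  obtain ⟨n, ⟨e⟩⟩ := Finite.exists_equiv_fin α
  -- Ties are broken by the enumeration `e`, which makes the pieces disjoint.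
  refine ⟨fun i => {x | ∀ j, a j x < a i x ∨ a j x = a i x ∧ e j ≤ e i}, fun i => ?_, fun x => ?_,
    fun x i j hi hj => ?_, fun i x hi j => ?_⟩
  · have : {x | ∀ j, a j x < a i x ∨ a j x = a i x ∧ e j ≤ e i} =
        ⋂ j, if e j ≤ e i then {x | a j x ≤ a i x} else {x | a j x < a i x} := by
      ext x
      simp only [Set.mem_ofPred_eq, Set.mem_iInter]
      refine forall_congr' fun j => ?_
      split_ifs with h <;> simp [h, le_iff_lt_or_eq]
    refine (congrArg IsPolyhedral this).mpr <| IsPolyhedral.iInter fun j => ?_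
    split_ifs
    · exact isPolyhedral_le _ _
    · exact isPolyhedral_lt _ _
  · obtain ⟨i, hi⟩ := Finite.exists_max fun i => toLex (a i x, e i)
    exact ⟨i, fun j => Prod.Lex.toLex_le_toLex.1 (hi j)⟩
  · apply e.injective
    rcases hi j with h | ⟨h, h'⟩ <;> rcases hj i with k | ⟨k, k'⟩
    · exact absurd h k.not_gt
    · exact absurd h k.not_gt
    · exact absurd k h.not_gt
    · exact le_antisymm k' h'
  · rcases hi j with h | h
    · exact h.le
    · exact h.1.le

/-- The fibres of a polyhedral set over the first factor are empty off a polyhedral set `K`. Over `K`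
they are, up to end points, the open intervals cut out by finitely many affine lower bounds `Lo` and
upper bounds `Up`. -/
lemma IsPolyhedral.exists_bounds {S : Set (V × ℝ)} (hS : IsPolyhedral S) :
    ∃ (K : Set V) (Lo Up : Set (V →ᵃ[ℝ] ℝ)), IsPolyhedral K ∧ Lo.Finite ∧ Up.Finite ∧
      (∀ x s, (x, s) ∈ S → x ∈ K ∧ (∀ a ∈ Lo, a x ≤ s) ∧ ∀ b ∈ Up, s ≤ b x) ∧
      ∀ x ∈ K, ∀ s, (∀ a ∈ Lo, a x < s) → (∀ b ∈ Up, s < b x) → (x, s) ∈ S := by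
  obtain ⟨A, B, hA, hB, rfl⟩ := hS
  let c : (V × ℝ →ᵃ[ℝ] ℝ) → ℝ := fun g => g.linear (0, 1)
  let base : (V × ℝ →ᵃ[ℝ] ℝ) → V →ᵃ[ℝ] ℝ := fun g => g.comp (graphMap (AffineMap.const ℝ V 0))
  let root : (V × ℝ →ᵃ[ℝ] ℝ) → V →ᵃ[ℝ] ℝ := fun g => (-(c g)⁻¹) • base g
  have hg : ∀ g x s, g (x, s) = base g x + s * c g := fun g x s => affine_apply_prod g x s
  have hroot : ∀ g x s, c g ≠ 0 → g (x, s) = (s - root g x) * c g := by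
    intro g x s h
    rw [hg]
    simp only [root, AffineMap.coe_smul, Pi.smul_apply, smul_eq_mul]
    field_simp
    ring
  refine ⟨{x | (∀ g ∈ base '' {g ∈ A | c g = 0}, 0 < g x) ∧
      ∀ g ∈ base '' {g ∈ B | c g = 0}, 0 ≤ g x},
    root '' {g ∈ A ∪ B | 0 < c g}, root '' {g ∈ A ∪ B | c g < 0},
    ⟨_, _, (hA.subset (Set.sep_subset _ _)).image _, (hB.subset (Set.sep_subset _ _)).image _, rfl⟩,
    ((hA.union hB).subset (Set.sep_subset _ _)).image _,
    ((hA.union hB).subset (Set.sep_subset _ _)).image _, ?_, ?_⟩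
  · rintro x s ⟨h1, h2⟩
    have h12 : ∀ g ∈ A ∪ B, 0 ≤ g (x, s) := by
      rintro g (h | h)
      · exact (h1 g h).le
      · exact h2 g h
    refine ⟨⟨?_, ?_⟩, ?_, ?_⟩
    · rintro _ ⟨g, ⟨hg1, hg2⟩, rfl⟩
      simpa [hg, hg2] using h1 g hg1
    · rintro _ ⟨g, ⟨hg1, hg2⟩, rfl⟩
      simpa [hg, hg2] using h2 g hg1
    · rintro _ ⟨g, ⟨hg1, hg2⟩, rfl⟩
      have := h12 g hg1
      rw [hroot g x s hg2.ne'] at this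
      linarith [nonneg_of_mul_nonneg_left this hg2]
    · rintro _ ⟨g, ⟨hg1, hg2⟩, rfl⟩
      have := h12 g hg1
      rw [hroot g x s hg2.ne] at this
      nlinarith
  · rintro x ⟨hK1, hK2⟩ s hLo hUp
    have h12 : ∀ g ∈ A ∪ B, c g ≠ 0 → 0 < g (x, s) := by
      intro g h hc
      rw [hroot g x s hc]
      rcases hc.lt_or_gt with h' | h'
      · exact mul_pos_of_neg_of_neg (sub_neg.2 (hUp _ ⟨g, ⟨h, h'⟩, rfl⟩)) h'
      · exact mul_pos (sub_pos.2 (hLo _ ⟨g, ⟨h, h'⟩, rfl⟩)) h'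
    refine ⟨fun g hgA => ?_, fun g hgB => ?_⟩
    · by_cases hc : c g = 0
      · simpa [hg, hc] using hK1 _ ⟨g, ⟨hgA, hc⟩, rfl⟩
      · exact h12 g (Or.inl hgA) hc
    · by_cases hc : c g = 0
      · simpa [hg, hc] using hK2 _ ⟨g, ⟨hgB, hc⟩, rfl⟩
      · exact (h12 g (Or.inr hgB) hc).le

lemma integrable_indicator_of_isBounded {E : Type*} [NormedAddCommGroup E] [NormedSpace ℝ E]
    [FiniteDimensional ℝ E] [MeasureSpace E] [BorelSpace E]
    [IsFiniteMeasureOnCompacts (volume : Measure E)] {S : Set E} (hS : IsPolyhedral S)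
    (hb : Bornology.IsBounded S) {r : E → ℝ} (hr : r ∈ polyFun E) :
    Integrable (S.indicator r) := by
  rw [integrable_indicator_iff hS.measurableSet]
  have : ProperSpace E := FiniteDimensional.proper_real E
  exact ((continuous_of_mem_polyFun hr).continuousOn.integrableOn_compact
    hb.isCompact_closure).mono_set subset_closure

lemma integrable_indicator_fiber {E : Type*} [NormedAddCommGroup E] [NormedSpace ℝ E]
    [FiniteDimensional ℝ E] [MeasureSpace E] [BorelSpace E]
    [IsFiniteMeasureOnCompacts (volume : Measure E)] {S : Set (V × E)} (hS : IsPolyhedral S)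
    {x : V} (hb : Bornology.IsBounded {z | (x, z) ∈ S}) {r : V × E → ℝ} (hr : r ∈ polyFun (V × E)) :
    Integrable fun z => S.indicator r (x, z) :=
  integrable_indicator_of_isBounded (hS.preimage (fiberMap x)) hb (comp_mem_polyFun hr (fiberMap x))

/-- Integrating out one real variable: a polynomial over a polyhedral set with bounded fibres
integrates to a piecewise polynomial function. -/
lemma integral_indicator_mem_piecewisePoly {S : Set (V × ℝ)} (hS : IsPolyhedral S)
    (hb : ∀ x, Bornology.IsBounded {s | (x, s) ∈ S}) {r : V × ℝ → ℝ} (hr : r ∈ polyFun (V × ℝ)) :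
    (fun x => ∫ s, S.indicator r (x, s)) ∈ piecewisePoly {x | ∃ s, (x, s) ∈ S} := by
  obtain ⟨K, Lo, Up, hK, hLo, hUp, hSK, hKS⟩ := hS.exists_bounds
  obtain ⟨F, hF, hF'⟩ := exists_antideriv hr
  have hfin : ∀ (T : Set (V →ᵃ[ℝ] ℝ)) (x : V), T.Finite → ((fun g => g x) '' T).Finite :=
    fun T x h => h.image _
  -- Without lower or without upper bounds a nonempty fibre would be unbounded.
  have hKempty : ∀ x ∈ K, Lo.Nonempty ∧ Up.Nonempty := by
    refine fun x hx => ⟨?_, ?_⟩ <;> by_contra h <;> rw [Set.not_nonempty_iff_eq_empty] at h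
    · obtain ⟨m, hm⟩ := (hfin Up x hUp).bddBelow
      refine not_bddBelow_Iio m ((hb x).bddBelow.mono fun s hs => hKS x hx s (by simp [h]) ?_)
      exact fun b hb => lt_of_lt_of_le hs (hm ⟨b, hb, rfl⟩)
    · obtain ⟨m, hm⟩ := (hfin Lo x hLo).bddAbove
      refine not_bddAbove_Ioi m ((hb x).bddAbove.mono fun s hs => hKS x hx s ?_ (by simp [h]))
      exact fun b hb => lt_of_le_of_lt (hm ⟨b, hb, rfl⟩) hs
  by_cases hne : Lo.Nonempty ∧ Up.Nonempty
  swap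
  · have : (fun x => ∫ s, S.indicator r (x, s)) = 0 := by
      funext x
      have h0 : ∀ s, S.indicator r (x, s) = 0 := fun s =>
        Set.indicator_of_notMem (fun h => hne (hKempty x (hSK x s h).1)) _
      simp [h0]
    rw [this]
    exact zero_mem _
  have := hne.1.to_subtype
  have := hne.2.to_subtype
  have := hLo.to_subtype
  have := hUp.to_subtype
  have := Fintype.ofFinite Lo
  have := Fintype.ofFinite Up
  obtain ⟨D, hD, hDex, hDdisj, hDmax⟩ := exists_selector fun a : Lo => (a : V →ᵃ[ℝ] ℝ)
  obtain ⟨D', hD', hDex', hDdisj', hDmax'⟩ := exists_selector fun b : Up => -(b : V →ᵃ[ℝ] ℝ)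
  -- On `D a ∩ D' b` the fibre is the interval from `a` to `b`.
  have key : (fun x => ∫ s, S.indicator r (x, s)) = ∑ a : Lo, ∑ b : Up,
      (D a ∩ D' b ∩ {x | a.1 x < b.1 x} ∩ K).indicator (F ∘ graphMap b.1 - F ∘ graphMap a.1) := by
    funext x
    by_cases hx : x ∈ K
    swap
    · have h0 : ∀ s, S.indicator r (x, s) = 0 := fun s =>
        Set.indicator_of_notMem (fun h => hx (hSK x s h).1) _
      simp [h0, hx, Finset.sum_apply]
    obtain ⟨a, ha⟩ := hDex x
    obtain ⟨b, hb'⟩ := hDex' x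
    rw [Finset.sum_apply, Finset.sum_eq_single a, Finset.sum_apply, Finset.sum_eq_single b]
    · have hamax : ∀ a' ∈ Lo, a' x ≤ a.1 x := fun a' h => hDmax a x ha ⟨a', h⟩
      have hbmin : ∀ b' ∈ Up, b.1 x ≤ b' x := fun b' h => by
        simpa using hDmax' b x hb' ⟨b', h⟩
      have hcont : Continuous fun s => r (x, s) :=
        continuous_of_mem_polyFun (comp_mem_polyFun hr (fiberMap x))
      have hae : ∀ᵐ s : ℝ, s ≠ a.1 x ∧ s ≠ b.1 x :=
        (ae_iff.2 (by simp)).and (ae_iff.2 (by simp))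
      by_cases hab : a.1 x < b.1 x
      · rw [Set.indicator_of_mem (by exact ⟨⟨⟨ha, hb'⟩, hab⟩, hx⟩)]
        have h1 : ∫ s, S.indicator r (x, s) =
            ∫ s, (Set.Ioc (a.1 x) (b.1 x)).indicator (fun s => r (x, s)) s := by
          refine integral_congr_ae ?_
          filter_upwards [hae] with s hs
          by_cases hsS : (x, s) ∈ S
          · rw [Set.indicator_of_mem hsS, Set.indicator_of_mem]
            exact ⟨lt_of_le_of_ne ((hSK x s hsS).2.1 a a.2) hs.1.symm, (hSK x s hsS).2.2 b b.2⟩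
          · rw [Set.indicator_of_notMem hsS, Set.indicator_of_notMem]
            exact fun h => hsS (hKS x hx s (fun a' h' => (hamax a' h').trans_lt h.1)
              fun b' h' => (lt_of_le_of_ne h.2 hs.2).trans_le (hbmin b' h'))
        rw [h1, integral_indicator measurableSet_Ioc, ← intervalIntegral.integral_of_le hab.le,
          intervalIntegral.integral_eq_sub_of_hasDerivAt (fun s _ => hF' x s)
            (hcont.intervalIntegrable _ _)]
        rfl
      · rw [Set.indicator_of_notMem (fun h => hab h.1.2), integral_eq_zero_of_ae]
        filter_upwards [hae] with s hs
        refine Set.indicator_of_notMem (fun h => hs.1 ?_) _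
        have := (hSK x s h).2
        exact le_antisymm ((this.2 b b.2).trans (not_lt.1 hab)) (this.1 a a.2)
    · intro b₁ _ hb₁
      exact Set.indicator_of_notMem (fun h => hb₁ (hDdisj' x _ _ h.1.1.2 hb')) _
    · simp
    · intro a₁ _ ha₁
      rw [Finset.sum_apply]
      exact Finset.sum_eq_zero fun b₁ _ =>
        Set.indicator_of_notMem (fun h => ha₁ (hDdisj x _ _ h.1.1.1 ha)) _
    · simp
  rw [key]
  refine sum_mem fun a _ => sum_mem fun b _ => indicator_mem_piecewisePoly
    ((((hD a).inter (hD' b)).inter (isPolyhedral_lt _ _)).inter hK) ?_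
    (sub_mem (comp_mem_polyFun hF _) (comp_mem_polyFun hF _))
  rintro x ⟨⟨⟨ha, hb'⟩, hab⟩, hx⟩
  obtain ⟨s, hs⟩ := exists_between (show a.1 x < b.1 x from hab)
  exact ⟨s, hKS x hx s (fun a' h' => (hDmax a x ha ⟨a', h'⟩).trans_lt hs.1)
    fun b' h' => hs.2.trans_le (by simpa using hDmax' b x hb' ⟨b', h'⟩)⟩

/-- One variable can be integrated out of a piecewise polynomial function with bounded fibres. The
integrability is what makes the integral additive over the pieces. -/
lemma integral_mem_piecewisePoly {T : Set (V × ℝ)}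
    (hb : ∀ x, Bornology.IsBounded {s | (x, s) ∈ T}) {h : V × ℝ → ℝ} (hh : h ∈ piecewisePoly T) :
    (∀ x, Integrable fun s => h (x, s)) ∧
      (fun x => ∫ s, h (x, s)) ∈ piecewisePoly {x | ∃ s, (x, s) ∈ T} := by
  induction hh using Submodule.span_induction with
  | mem f hf =>
    obtain ⟨S, r, hS, hST, hr, rfl⟩ := hf
    have hb' : ∀ x, Bornology.IsBounded {s | (x, s) ∈ S} := fun x =>
      (hb x).subset fun s hs => hST hs
    exact ⟨fun x => integrable_indicator_fiber hS (hb' x) hr,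
      piecewisePoly_mono (fun x hx => hx.imp fun s hs => hST hs)
        (integral_indicator_mem_piecewisePoly hS hb' hr)⟩
  | zero => exact ⟨fun x => integrable_zero _ _ _, by simpa using! zero_mem _⟩
  | add f g _ _ hf hg =>
    refine ⟨fun x => (hf.1 x).add (hg.1 x), ?_⟩
    have : (fun x => ∫ s, (f + g) (x, s)) = (fun x => ∫ s, f (x, s)) + fun x => ∫ s, g (x, s) :=
      funext fun x => integral_add (hf.1 x) (hg.1 x)
    rw [this]
    exact add_mem hf.2 hg.2
  | smul c f _ hf =>
    refine ⟨fun x => (hf.1 x).smul c, ?_⟩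
    have : (fun x => ∫ s, (c • f) (x, s)) = c • fun x => ∫ s, f (x, s) :=
      funext fun x => integral_smul c _
    rw [this]
    exact Submodule.smul_mem _ c hf.2

/-- The affine map `((x, s), z) ↦ (x, (s, z))` that moves the first coordinate of the second factor
to the first factor. -/
def consMap (V : Type*) [AddCommGroup V] [Module ℝ V] (n : ℕ) :
    (V × ℝ) × (Fin n → ℝ) →ᵃ[ℝ] V × (Fin (n + 1) → ℝ) :=
  LinearMap.toAffineMap
    { toFun := fun p => (p.1.1, Fin.cons p.1.2 p.2)
      map_add' := fun p q =>
        Prod.ext rfl (funext fun i => by refine Fin.cases ?_ (fun j => ?_) i <;> rfl)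
      map_smul' := fun c p =>
        Prod.ext rfl (funext fun i => by refine Fin.cases ?_ (fun j => ?_) i <;> rfl) }

/-- Integrating out several real variables, one at a time. -/
theorem integral_fin_mem_piecewisePoly (n : ℕ) {S : Set (V × (Fin n → ℝ))} (hS : IsPolyhedral S)
    (hb : ∀ x, Bornology.IsBounded {z | (x, z) ∈ S}) {r : V × (Fin n → ℝ) → ℝ}
    (hr : r ∈ polyFun (V × (Fin n → ℝ))) :
    (fun x => ∫ z, S.indicator r (x, z)) ∈ piecewisePoly {x | ∃ z, (x, z) ∈ S} := by
  induction n generalizing V with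
  | zero =>
    let γ : V →ᵃ[ℝ] V × (Fin 0 → ℝ) := graphMap (AffineMap.const ℝ V 0)
    have : (fun x => ∫ z, S.indicator r (x, z)) = (γ ⁻¹' S).indicator (r ∘ γ) := by
      funext x
      rw [Measure.volume_pi_eq_dirac 0, integral_dirac]
      rfl
    rw [this]
    refine indicator_mem_piecewisePoly (hS.preimage γ) ?_ (comp_mem_polyFun hr γ)
    intro x hx
    exact ⟨0, hx⟩
  | succ n ih =>
    have e := (volume_preserving_piFinSuccAbove (fun _ : Fin (n + 1) => ℝ) 0).symm
    have hb' : ∀ p : V × ℝ, Bornology.IsBounded {z | (p, z) ∈ consMap V n ⁻¹' S} := by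
      refine fun p => Bornology.forall_isBounded_image_eval_iff.1 fun i =>
        (Bornology.forall_isBounded_image_eval_iff.2 (hb p.1) i.succ).subset ?_
      rintro _ ⟨z, hz, rfl⟩
      exact ⟨Fin.cons p.2 z, hz, rfl⟩
    have h := ih (hS.preimage (consMap V n)) hb' (comp_mem_polyFun hr (consMap V n))
    have hbT : ∀ x, Bornology.IsBounded {s | (x, s) ∈ {p | ∃ z, (p, z) ∈ consMap V n ⁻¹' S}} := by
      refine fun x => (Bornology.forall_isBounded_image_eval_iff.2 (hb x) 0).subset ?_
      rintro s ⟨z, hz⟩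
      exact ⟨Fin.cons s z, hz, rfl⟩
    have h' := (integral_mem_piecewisePoly hbT h).2
    have : (fun x => ∫ z, S.indicator r (x, z)) = fun x => ∫ s, ∫ z,
        (consMap V n ⁻¹' S).indicator (r ∘ consMap V n) ((x, s), z) := by
      funext x
      have hint := integrable_indicator_fiber hS (hb x) hr
      rw [← e.integral_comp', Measure.volume_eq_prod]
      refine (integral_prod _ (e.integrable_comp_of_integrable hint)).trans ?_
      refine integral_congr_ae (.of_forall fun s => integral_congr_ae (.of_forall fun z => ?_))
      have : (MeasurableEquiv.piFinSuccAbove (fun _ : Fin (n + 1) => ℝ) 0).symm (s, z) =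
          Fin.cons s z := Fin.insertNth_zero' s z
      simp only [Function.comp_apply, this]
      rfl
    rw [this]
    refine piecewisePoly_mono ?_ h'
    rintro x ⟨s, z, hz⟩
    exact ⟨_, hz⟩

/-- Integrating out several real variables with an arbitrary finite index type. -/
theorem integral_fiber_mem_piecewisePoly {α : Type*} [Fintype α] {S : Set (V × (α → ℝ))}
    (hS : IsPolyhedral S) (hb : ∀ x, Bornology.IsBounded {z | (x, z) ∈ S})
    {r : V × (α → ℝ) → ℝ} (hr : r ∈ polyFun (V × (α → ℝ))) :
    (fun x => ∫ z, S.indicator r (x, z)) ∈ piecewisePoly {x | ∃ z, (x, z) ∈ S} := by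
  let e := Fintype.equivFin α
  let φ : V × (Fin (Fintype.card α) → ℝ) →ᵃ[ℝ] V × (α → ℝ) :=
    (LinearMap.id.prodMap (LinearMap.funLeft ℝ ℝ e)).toAffineMap
  have hb' : ∀ x, Bornology.IsBounded {z | (x, z) ∈ φ ⁻¹' S} := by
    refine fun x => Bornology.forall_isBounded_image_eval_iff.1 fun i =>
      (Bornology.forall_isBounded_image_eval_iff.2 (hb x) (e.symm i)).subset ?_
    rintro _ ⟨z, hz, rfl⟩
    exact ⟨z ∘ e, hz, by simp⟩
  have h := integral_fin_mem_piecewisePoly _ (hS.preimage φ) hb' (comp_mem_polyFun hr φ)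
  have : (fun x => ∫ z, S.indicator r (x, z)) =
      fun x => ∫ z, (φ ⁻¹' S).indicator (r ∘ φ) (x, z) := by
    funext x
    have hmp := (volume_measurePreserving_piCongrLeft (fun _ : α => ℝ) e.symm)
    rw [← hmp.integral_comp']
    refine integral_congr_ae (Filter.Eventually.of_forall fun z => ?_)
    have : MeasurableEquiv.piCongrLeft (fun _ : α => ℝ) e.symm z = z ∘ e := by
      funext i
      obtain ⟨j, rfl⟩ := e.symm.surjective i
      rw [MeasurableEquiv.coe_piCongrLeft, Equiv.piCongrLeft_apply_apply]
      simp
    simp only [this]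
    rfl
  rw [this]
  refine piecewisePoly_mono ?_ h
  rintro x ⟨z, hz⟩
  exact ⟨_, hz⟩

end Elimination

/-! ### Piecewise polynomial functions on the line -/

section Univariate

/-- `f` agrees with a polynomial on each of the finitely many sets into which the points of a finite
set `E` divide the line, namely the points of `E` and the components of its complement. Such a set
is given by the signs `σ e` of the differences `t - e` for `e ∈ E`. -/
def HasPolyPieces (f : ℝ → ℝ) : Prop :=
  ∃ E : Finset ℝ, ∀ σ : ℝ → SignType, ∃ q : Polynomial ℝ,
    ∀ t, (∀ e ∈ E, SignType.sign (t - e) = σ e) → f t = q.eval t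

lemma hasPolyPieces_zero : HasPolyPieces 0 := ⟨∅, fun _ => ⟨0, fun t _ => by simp⟩⟩

lemma HasPolyPieces.add {f g : ℝ → ℝ} (hf : HasPolyPieces f) (hg : HasPolyPieces g) :
    HasPolyPieces (f + g) := by
  obtain ⟨E, hE⟩ := hf
  obtain ⟨E', hE'⟩ := hg
  refine ⟨E ∪ E', fun σ => ?_⟩
  obtain ⟨q, hq⟩ := hE σ
  obtain ⟨q', hq'⟩ := hE' σ
  refine ⟨q + q', fun t ht => ?_⟩
  rw [Pi.add_apply, Polynomial.eval_add, hq t fun e he => ht e (Finset.mem_union_left _ he),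
    hq' t fun e he => ht e (Finset.mem_union_right _ he)]

lemma HasPolyPieces.sum {α : Type*} (s : Finset α) {f : α → ℝ → ℝ}
    (hf : ∀ a ∈ s, HasPolyPieces (f a)) : HasPolyPieces (∑ a ∈ s, f a) :=
  Finset.sum_induction f HasPolyPieces (fun _ _ => HasPolyPieces.add) hasPolyPieces_zero hf

lemma HasPolyPieces.smul {f : ℝ → ℝ} (c : ℝ) (hf : HasPolyPieces f) : HasPolyPieces (c • f) := by
  obtain ⟨E, hE⟩ := hf
  refine ⟨E, fun σ => ?_⟩
  obtain ⟨q, hq⟩ := hE σ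
  exact ⟨c • q, fun t ht => by simp [hq t ht]⟩

/-- Changing a function at finitely many points only adds one-point pieces. -/
lemma HasPolyPieces.congr_off_finite {f g : ℝ → ℝ} (hf : HasPolyPieces f) {F : Set ℝ}
    (hF : F.Finite) (h : ∀ t ∉ F, g t = f t) : HasPolyPieces g := by
  obtain ⟨E, hE⟩ := hf
  refine ⟨E ∪ hF.toFinset, fun σ => ?_⟩
  by_cases hσ : ∃ e ∈ F, σ e = 0
  · obtain ⟨e, he, hσe⟩ := hσ
    refine ⟨Polynomial.C (g e), fun t ht => ?_⟩
    have := ht e (Finset.mem_union_right _ (hF.mem_toFinset.2 he))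
    rw [hσe, sign_eq_zero_iff, sub_eq_zero] at this
    simp [this]
  · obtain ⟨q, hq⟩ := hE σ
    refine ⟨q, fun t ht => ?_⟩
    rw [h t, hq t fun e he => ht e (Finset.mem_union_left _ he)]
    intro htF
    refine hσ ⟨t, htF, ?_⟩
    rw [← ht t (Finset.mem_union_right _ (hF.mem_toFinset.2 htF))]
    simp

/-- The end points of an interval decide membership in it. -/
lemma exists_finset_decides_of_ordConnected {J : Set ℝ} (hJ : J.OrdConnected) :
    ∃ E : Finset ℝ, ∀ s t, (∀ e ∈ E, SignType.sign (s - e) = SignType.sign (t - e)) →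
      s ∈ J → t ∈ J := by
  -- If `J` is unbounded below or above, `sInf J` or `sSup J` is an arbitrary additional point.
  refine ⟨{sInf J, sSup J}, fun s t h hs => ?_⟩
  have hinf := h (sInf J) (by simp)
  have hsup := h (sSup J) (by simp)
  rcases lt_trichotomy t s with hts | rfl | hts
  · by_cases hu : ∃ u ∈ J, u ≤ t
    · obtain ⟨u, hu, hut⟩ := hu
      exact hJ.out hu hs ⟨hut, hts.le⟩
    · push Not at hu
      have h1 : t ≤ sInf J := le_csInf ⟨s, hs⟩ fun u hu' => (hu u hu').le
      have h2 : sInf J ≤ s := csInf_le ⟨t, fun u hu' => (hu u hu').le⟩ hs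
      rcases h2.lt_or_eq with h3 | h3
      · rw [sign_pos (sub_pos.2 h3)] at hinf
        exact absurd (sign_eq_one_iff.1 hinf.symm) (not_lt.2 (sub_nonpos.2 h1))
      · rw [h3, sub_self, sign_zero] at hinf
        have := sign_eq_zero_iff.1 hinf.symm
        linarith
  · exact hs
  · by_cases hu : ∃ u ∈ J, t ≤ u
    · obtain ⟨u, hu, hut⟩ := hu
      exact hJ.out hs hu ⟨hts.le, hut⟩
    · push Not at hu
      have h1 : sSup J ≤ t := csSup_le ⟨s, hs⟩ fun u hu' => (hu u hu').le
      have h2 : s ≤ sSup J := le_csSup ⟨t, fun u hu' => (hu u hu').le⟩ hs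
      rcases h2.lt_or_eq with h3 | h3
      · rw [sign_neg (sub_neg.2 h3)] at hsup
        exact absurd (sign_eq_neg_one_iff.1 hsup.symm) (not_lt.2 (sub_nonneg.2 h1))
      · rw [← h3, sub_self, sign_zero] at hsup
        have := sign_eq_zero_iff.1 hsup.symm
        linarith

lemma hasPolyPieces_of_mem_piecewisePoly {T : Set ℝ} {f : ℝ → ℝ} (hf : f ∈ piecewisePoly T) :
    HasPolyPieces f := by
  induction hf using Submodule.span_induction with
  | mem f hf =>
    obtain ⟨S, r, hS, -, hr, rfl⟩ := hf
    obtain ⟨E, hE⟩ := exists_finset_decides_of_ordConnected hS.convex.ordConnected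
    obtain ⟨q, hq⟩ := exists_polynomial_of_mem_polyFun hr
    refine ⟨E, fun σ => ?_⟩
    by_cases h : ∃ s ∈ S, ∀ e ∈ E, SignType.sign (s - e) = σ e
    · obtain ⟨s, hs, hsσ⟩ := h
      refine ⟨q, fun t ht => ?_⟩
      rw [Set.indicator_of_mem (hE s t (fun e he => (hsσ e he).trans (ht e he).symm) hs), hq]
    · exact ⟨0, fun t ht => by
        rw [Set.indicator_of_notMem fun hts => h ⟨t, hts, ht⟩, Polynomial.eval_zero]⟩
  | zero => exact hasPolyPieces_zero
  | add f g _ _ hf hg => exact hf.add hg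
  | smul c f _ hf => exact hf.smul c

/-- The end points of finitely many intervals can be added to the division points of `f`, after
which each piece lies inside or outside of the union of the intervals. -/
lemma HasPolyPieces.isPiecewisePolynomialOn {f : ℝ → ℝ} (hf : HasPolyPieces f) {α : Type*}
    [Finite α] {J : α → Set ℝ} (hJ : ∀ a, (J a).OrdConnected) :
    IsPiecewisePolynomialOn f (⋃ a, J a) := by
  obtain ⟨E₀, hE₀⟩ := hf
  choose E' hE' using fun a => exists_finset_decides_of_ordConnected (hJ a)
  have := Fintype.ofFinite α
  let E := E₀ ∪ Finset.univ.biUnion E'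
  let piece : (E → SignType) → Set ℝ := fun τ => {t | ∀ e : E, SignType.sign (t - e) = τ e}
  have hmem : ∀ τ s t, s ∈ piece τ → t ∈ piece τ → s ∈ ⋃ a, J a → t ∈ ⋃ a, J a := by
    intro τ s t hs ht hsI
    obtain ⟨a, ha⟩ := Set.mem_iUnion.1 hsI
    refine Set.mem_iUnion.2 ⟨a, hE' a s t (fun e he => ?_) ha⟩
    have heE : e ∈ E :=
      Finset.mem_union_right _ (Finset.mem_biUnion.2 ⟨a, Finset.mem_univ _, he⟩)
    exact (hs ⟨e, heE⟩).trans (ht ⟨e, heE⟩).symm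
  have hpoly : ∀ τ, ∃ q : Polynomial ℝ, ∀ t ∈ piece τ, f t = q.eval t := by
    intro τ
    obtain ⟨q, hq⟩ := hE₀ fun e => if h : e ∈ E then τ ⟨e, h⟩ else 0
    refine ⟨q, fun t ht => hq t fun e he => ?_⟩
    have heE : e ∈ E := Finset.mem_union_left _ he
    rw [dif_pos heE]
    exact ht ⟨e, heE⟩
  choose q hq using hpoly
  have hsign : Monotone (SignType.sign : ℝ → SignType) := SignType.sign.monotone
  let eqv := Fintype.equivFin (E → SignType)
  refine ⟨_, fun i => piece (eqv.symm i) ∩ ⋃ a, J a, fun i => q (eqv.symm i), fun i => ?_,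
    fun i j hij => ?_, ?_, fun i t ht => hq _ t ht.1⟩
  · refine ⟨fun s hs u hu t ht => ?_⟩
    have htp : t ∈ piece (eqv.symm i) := fun e =>
      le_antisymm ((hsign (sub_le_sub_right ht.2 _)).trans_eq (hu.1 e))
        ((hs.1 e).symm.trans_le (hsign (sub_le_sub_right ht.1 _)))
    exact ⟨htp, hmem _ s t hs.1 htp hs.2⟩
  · refine Set.disjoint_left.2 fun t hi hj => hij (eqv.symm.injective (funext fun e => ?_))
    exact (hi.1 e).symm.trans (hj.1 e)
  · ext t
    simp only [Set.mem_iUnion, Set.mem_inter_iff]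
    refine ⟨fun ⟨_, _, h⟩ => h, fun h => ⟨eqv fun e => SignType.sign (t - e), ?_, h⟩⟩
    intro e
    simp

end Univariate

/-! ### Polynomials integrable over unbounded polyhedral sets -/

section Unbounded

variable {E : Type*} [NormedAddCommGroup E] [NormedSpace ℝ E] [FiniteDimensional ℝ E]

/-- An unbounded set that is cut out by strict affine inequalities is mapped to itself by the
translations along some ray. -/
lemma exists_recession_direction {A : Set (E →ᵃ[ℝ] ℝ)}
    (hb : ¬ Bornology.IsBounded {x | ∀ g ∈ A, 0 < g x}) :
    ∃ v : E, ‖v‖ = 1 ∧ ∀ g ∈ A, 0 ≤ g.linear v := by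
  have hne : {x | ∀ g ∈ A, 0 < g x}.Nonempty := by
    by_contra h
    rw [Set.not_nonempty_iff_eq_empty] at h
    exact hb (h ▸ Bornology.isBounded_empty)
  obtain ⟨x₀, hx₀⟩ := hne
  have hfar : ∀ n : ℕ, ∃ x, (∀ g ∈ A, 0 < g x) ∧ (n : ℝ) + 1 ≤ ‖x - x₀‖ := by
    intro n
    by_contra! h
    exact hb ((Metric.isBounded_ball (x := x₀) (r := n + 1)).subset fun x hx => by
      simpa [dist_eq_norm] using h x hx)
  choose x hx hxn using hfar
  have hpos : ∀ n, 0 < ‖x n - x₀‖ := fun n => lt_of_lt_of_le (by positivity) (hxn n)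
  have : ProperSpace E := FiniteDimensional.proper_real E
  -- The ray points in a limit direction of a sequence that goes to infinity in the set.
  obtain ⟨v, hv, φ, hφ, hlim⟩ := (isCompact_sphere (0 : E) 1).tendsto_subseq
    (x := fun n => ‖x n - x₀‖⁻¹ • (x n - x₀)) fun n => by
      simp [norm_smul, (hpos n).ne']
  refine ⟨v, by simpa using hv, fun g hg => ?_⟩
  have h1 : Filter.Tendsto (fun n => g.linear (‖x (φ n) - x₀‖⁻¹ • (x (φ n) - x₀))) Filter.atTop
      (nhds (g.linear v)) :=
    (g.linear.continuous_of_finiteDimensional.tendsto v).comp hlim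
  have h2 : Filter.Tendsto (fun n => -(g x₀ * (1 / ((φ n : ℕ) + 1 : ℝ)))) Filter.atTop
      (nhds 0) := by
    simpa using ((tendsto_one_div_add_atTop_nhds_zero_nat (𝕜 := ℝ)).comp
      hφ.tendsto_atTop).const_mul (g x₀) |>.neg
  refine le_of_tendsto_of_tendsto' h2 h1 fun n => ?_
  have h3 : g.linear (x (φ n) - x₀) = g (x (φ n)) - g x₀ := by
    simpa using g.linearMap_vsub (x (φ n)) x₀
  rw [map_smul, h3, smul_eq_mul]
  have h4 : ‖x (φ n) - x₀‖⁻¹ ≤ 1 / ((φ n : ℕ) + 1 : ℝ) := by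
    rw [← one_div]
    exact one_div_le_one_div_of_le (by positivity) (hxn _)
  have h5 := mul_le_mul_of_nonneg_left h4 (hx₀ g hg).le
  have h6 := mul_pos (inv_pos.2 (hpos (φ n))) (hx (φ n) g hg)
  nlinarith

lemma polynomial_eq_zero_of_tendsto_nat {p : Polynomial ℝ}
    (h : Filter.Tendsto (fun k : ℕ => p.eval (k : ℝ)) Filter.atTop (nhds 0)) : p = 0 := by
  by_cases hd : 0 < p.degree
  · have h1 := (p.abs_tendsto_atTop hd).comp (tendsto_natCast_atTop_atTop (R := ℝ))
    exact absurd h.abs (not_tendsto_nhds_of_tendsto_atTop h1 _)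
  · rw [Polynomial.eq_C_of_degree_le_zero (not_lt.1 hd)] at h ⊢
    simp only [Polynomial.eval_C] at h
    rw [tendsto_nhds_unique tendsto_const_nhds h, map_zero]

/-- A polynomial that is integrable over an unbounded open polyhedral set vanishes on it: its
restriction to almost every ray in a recession direction is a polynomial that is summable over the
integers. -/
lemma eq_zero_of_integrableOn_unbounded [MeasureSpace E] [BorelSpace E]
    [(volume : Measure E).IsAddHaarMeasure] {A : Set (E →ᵃ[ℝ] ℝ)} (hA : A.Finite)
    (hb : ¬ Bornology.IsBounded {x | ∀ g ∈ A, 0 < g x}) {q : E → ℝ} (hq : q ∈ polyFun E)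
    (hint : IntegrableOn q {x | ∀ g ∈ A, 0 < g x}) : ∀ x, (∀ g ∈ A, 0 < g x) → q x = 0 := by
  obtain ⟨v, hv, hrec⟩ := exists_recession_direction hb
  intro x₀ hx₀
  by_contra hq₀
  have hqc : Continuous q := continuous_of_mem_polyFun hq
  set S := {x | ∀ g ∈ A, 0 < g x} with hS
  have hopen : IsOpen (S ∩ {x | q x ≠ 0}) := by
    refine IsOpen.inter ?_ (isOpen_ne_fun hqc continuous_const)
    have : S = ⋂ g ∈ A, {x | 0 < g x} := by
      ext x
      simp [hS]
    rw [this]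
    exact hA.isOpen_biInter fun g _ =>
      isOpen_lt continuous_const g.continuous_of_finiteDimensional
  obtain ⟨ε, hε, hball⟩ := Metric.isOpen_iff.1 hopen x₀ ⟨hx₀, hq₀⟩
  -- Radius at most `1 / 2` makes the translates by integer multiples of `v` disjoint.
  set δ := min ε (1 / 2) with hδ
  have hδ0 : 0 < δ := lt_min hε (by norm_num)
  have hsub : Metric.ball x₀ δ ⊆ S ∩ {x | q x ≠ 0} :=
    (Metric.ball_subset_ball (min_le_left _ _)).trans hball
  have htrans : ∀ x ∈ S, ∀ k : ℕ, x + (k : ℝ) • v ∈ S := by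
    intro x hx k g hg
    have := g.map_vadd x ((k : ℝ) • v)
    rw [vadd_eq_add, vadd_eq_add, map_smul, smul_eq_mul, add_comm] at this
    rw [this]
    have := hx g hg
    have := hrec g hg
    positivity
  have hpre : ∀ k : ℕ, (fun x => x + (k : ℝ) • v) ⁻¹' Metric.ball (x₀ + (k : ℝ) • v) δ =
      Metric.ball x₀ δ := by
    intro k
    ext x
    simp
  have hshift : ∀ k : ℕ, ∫⁻ x in Metric.ball x₀ δ, ‖q (x + (k : ℝ) • v)‖ₑ =
      ∫⁻ x in Metric.ball (x₀ + (k : ℝ) • v) δ, ‖q x‖ₑ := by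
    intro k
    rw [← hpre k]
    exact (measurePreserving_add_right volume ((k : ℝ) • v)).setLIntegral_comp_preimage_emb
      (measurableEmbedding_addRight _) (fun x => ‖q x‖ₑ) _
  have hdisj : Pairwise (Function.onFun Disjoint
      fun k : ℕ => Metric.ball (x₀ + (k : ℝ) • v) δ) := by
    intro k l hkl
    refine Metric.ball_disjoint_ball ?_
    rw [dist_add_left, dist_eq_norm, ← sub_smul, norm_smul, hv, mul_one]
    have h1 : (1 : ℝ) ≤ ‖(k : ℝ) - l‖ := by
      have : (1 : ℤ) ≤ |(k : ℤ) - l| := Int.one_le_abs (sub_ne_zero.2 (by exact_mod_cast hkl))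
      rw [Real.norm_eq_abs]
      exact_mod_cast this
    have h2 : δ ≤ 1 / 2 := min_le_right _ _
    linarith
  have hmeas : ∀ k : ℕ, Measurable fun x => ‖q (x + (k : ℝ) • v)‖ₑ := fun k =>
    (hqc.comp (continuous_id.add continuous_const)).measurable.enorm
  have hfin : ∫⁻ x in Metric.ball x₀ δ, ∑' k : ℕ, ‖q (x + (k : ℝ) • v)‖ₑ ≠ ⊤ := by
    rw [lintegral_tsum fun k => (hmeas k).aemeasurable]
    simp_rw [hshift]
    rw [← lintegral_iUnion (fun k => measurableSet_ball) hdisj]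
    refine ne_top_of_le_ne_top hint.2.ne (lintegral_mono_set (Set.iUnion_subset fun k x hx => ?_))
    have hx' : x - (k : ℝ) • v ∈ Metric.ball x₀ δ := by
      rw [← hpre k]
      simpa using hx
    simpa using htrans _ (hsub hx').1 k
  have hae := ae_lt_top (Measurable.tsum hmeas) hfin
  have hfalse : ∀ᵐ x ∂(volume.restrict (Metric.ball x₀ δ)), False := by
    filter_upwards [hae, ae_restrict_mem measurableSet_ball] with x hx hxB
    obtain ⟨p, hp⟩ := exists_polynomial_of_mem_polyFun
      (comp_mem_polyFun hq (AffineMap.lineMap x (x + v)))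
    have hp' : ∀ s : ℝ, q (x + s • v) = p.eval s := by
      intro s
      rw [← hp]
      simp [AffineMap.lineMap_apply, add_comm]
    have h0 : Filter.Tendsto (fun k : ℕ => p.eval (k : ℝ)) Filter.atTop (nhds 0) := by
      have := ENNReal.tendsto_atTop_zero_of_tsum_ne_top hx.ne
      simp_rw [← hp']
      exact tendsto_zero_iff_enorm_tendsto_zero.2 this
    refine (hsub hxB).2 ?_
    have := hp' 0
    rwa [polynomial_eq_zero_of_tendsto_nat h0, zero_smul, add_zero, Polynomial.eval_zero] at this
  rw [Filter.eventually_false_iff_eq_bot, ae_eq_bot, Measure.restrict_eq_zero] at hfalse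
  exact (Metric.measure_ball_pos volume x₀ hδ0).ne' hfalse

end Unbounded

/-! ### Cells of an arrangement of affine functions -/

section SignCells

variable {ι J : Type*} [Finite J]

/-- The cell of the arrangement of the affine functions `g j` on which these have the signs
`τ j`. -/
def signCell (g : J → (ι → ℝ) →ᵃ[ℝ] ℝ) (τ : J → SignType) : Set (ι → ℝ) :=
  {x | ∀ j, SignType.sign (g j x) = τ j}

lemma isPolyhedral_signCell (g : J → (ι → ℝ) →ᵃ[ℝ] ℝ) (τ : J → SignType) :
    IsPolyhedral (signCell g τ) := by
  have : signCell g τ = ⋂ j, {x | SignType.sign (g j x) = τ j} := by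
    ext x
    simp [signCell]
  rw [this]
  exact IsPolyhedral.iInter fun j => isPolyhedral_sign _ _

/-- A cell on which no nonzero `g j` vanishes is defined by strict inequalities. -/
lemma exists_signCell_eq_pos {g : J → (ι → ℝ) →ᵃ[ℝ] ℝ} {τ : J → SignType}
    (h : ∀ j, τ j = 0 → g j = 0) :
    ∃ A : Set ((ι → ℝ) →ᵃ[ℝ] ℝ), A.Finite ∧ signCell g τ = {x | ∀ a ∈ A, 0 < a x} := by
  refine ⟨(fun j => (τ j : ℝ) • g j) '' {j | τ j ≠ 0}, (Set.toFinite _).image _, ?_⟩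
  ext x
  simp only [signCell, Set.mem_ofPred_eq, Set.forall_mem_image, AffineMap.coe_smul, Pi.smul_apply,
    smul_eq_mul]
  refine forall_congr' fun j => ?_
  rcases hτ : τ j with _ | _ | _
  · have := h j hτ
    simp [this]
  · simp [sign_eq_neg_one_iff]
  · simp [sign_eq_one_iff]

end SignCells

/-! ### Fibre integrals of cellwise polynomial functions -/

section Fibers

variable {ι : Type*} [DecidableEq ι]

/-- `glue y` as an affine map in the value of `y` and the values of the remaining variables. -/
def glueMap (y : ι) : ℝ × ({i : ι // i ≠ y} → ℝ) →ᵃ[ℝ] (ι → ℝ) :=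
  LinearMap.toAffineMap
    { toFun := fun p => glue y p.1 p.2
      map_add' := fun p q => by
        funext i
        by_cases h : i = y <;> simp [glue, h]
      map_smul' := fun c p => by
        funext i
        by_cases h : i = y <;> simp [glue, h] }

lemma glue_self (y : ι) (x : ι → ℝ) : glue y (x y) (fun i => x i) = x := by
  funext i
  by_cases h : i = y
  · subst h; simp [glue]
  · simp [glue, h]

lemma glue_apply_self (y : ι) (t : ℝ) (z : {i : ι // i ≠ y} → ℝ) : glue y t z y = t := by
  simp [glue]

lemma glue_apply_ne (y : ι) (t : ℝ) (z : {i : ι // i ≠ y} → ℝ) (i : {i : ι // i ≠ y}) :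
    glue y t z i = z i := by
  simp [glue, i.2]

/-- A nonzero affine function vanishes identically on at most one hyperplane `y = t`. -/
lemma subsingleton_vanishing_fibers (y : ι) {g : (ι → ℝ) →ᵃ[ℝ] ℝ} (hg : g ≠ 0) :
    {t | ∀ z, g (glue y t z) = 0}.Subsingleton := by
  intro t ht t' ht'
  by_contra hne
  refine hg (AffineMap.ext fun x => ?_)
  have hne' : t' - t ≠ 0 := sub_ne_zero.2 (Ne.symm hne)
  have : AffineMap.lineMap (glue y t fun i => x i) (glue y t' fun i => x i)
      ((x y - t) / (t' - t)) = x := by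
    funext i
    by_cases h : i = y
    · subst h
      simp [AffineMap.lineMap_apply, glue, hne']
    · simp [AffineMap.lineMap_apply, glue, h]
  rw [← this, g.apply_lineMap, ht, ht']
  simp

variable [Fintype ι]

/-- `glue` identifies Lebesgue measure with the product of the Lebesgue measures of the factors. -/
lemma measurePreserving_glue (y : ι) : MeasurePreserving
    (fun p : ℝ × ({i : ι // i ≠ y} → ℝ) => glue y p.1 p.2) := by
  have hmeas : Measurable fun p : ℝ × ({i : ι // i ≠ y} → ℝ) => glue y p.1 p.2 := by
    refine measurable_pi_lambda _ fun i => ?_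
    by_cases h : i = y
    · simpa [glue, h] using measurable_fst
    · simpa [glue, h] using measurable_pi_iff.1 measurable_snd (⟨i, h⟩ : {i : ι // i ≠ y})
  refine ⟨hmeas, (Measure.pi_eq fun s hs => ?_).symm⟩
  have hpre : (fun p : ℝ × ({i : ι // i ≠ y} → ℝ) => glue y p.1 p.2) ⁻¹' Set.univ.pi s =
      s y ×ˢ Set.univ.pi fun i : {i : ι // i ≠ y} => s i := by
    ext p
    simp only [Set.mem_preimage, Set.mem_univ_pi, Set.mem_prod]
    refine ⟨fun h => ⟨by simpa [glue] using h y, fun i => by simpa [glue, i.2] using h i⟩,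
      fun h i => ?_⟩
    by_cases hi : i = y
    · subst hi
      simpa [glue] using h.1
    · simpa [glue, hi] using h.2 ⟨i, hi⟩
  rw [Measure.map_apply hmeas (MeasurableSet.univ_pi hs), hpre, Measure.volume_eq_prod,
    Measure.prod_prod, volume_pi, Measure.pi_pi,
    Fintype.prod_eq_mul_prod_subtype_ne (fun i => volume (s i)) y]

lemma measurableEmbedding_glue (y : ι) : MeasurableEmbedding
    (fun p : ℝ × ({i : ι // i ≠ y} → ℝ) => glue y p.1 p.2) := by
  refine (MeasurableEquiv.mk (Equiv.mk (fun p : ℝ × ({i : ι // i ≠ y} → ℝ) => glue y p.1 p.2)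
    (fun x => (x y, fun i => x i)) (fun p => ?_) (fun x => glue_self y x))
    (measurePreserving_glue y).measurable ?_).measurableEmbedding
  · exact Prod.ext (glue_apply_self _ _ _) (funext fun i => glue_apply_ne _ _ _ i)
  · exact (measurable_pi_apply y).prodMk (measurable_pi_lambda _ fun i => measurable_pi_apply _)

/-- The zero set of an affine function that is not identically zero is null, being a proper affine
subspace. -/
lemma volume_zeros_eq_zero {E : Type*} [NormedAddCommGroup E] [NormedSpace ℝ E]
    [FiniteDimensional ℝ E] [MeasureSpace E] [BorelSpace E] [(volume : Measure E).IsAddHaarMeasure]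
    {g : E →ᵃ[ℝ] ℝ} (hg : ∃ x, g x ≠ 0) : volume {x | g x = 0} = 0 := by
  obtain ⟨x, hx⟩ := hg
  have h := Measure.addHaar_affineSubspace volume
    (AffineSubspace.comap g (⊥ : Submodule ℝ ℝ).toAffineSubspace) fun h => hx <| by
      have : x ∈ AffineSubspace.comap g (⊥ : Submodule ℝ ℝ).toAffineSubspace :=
        h ▸ AffineSubspace.mem_top ℝ E x
      simpa using this
  convert h using 2
  ext x
  simp

variable {J : Type*} [Finite J]

/-- The contribution of one cell. If the cell lies in a hyperplane, its fibres are null with at most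
one exception. Otherwise it is open, and then either bounded, so that the variables other than `y`
can be integrated out, or the integrable polynomial vanishes on it. -/
lemma exists_finite_fiber_signCell (g : J → (ι → ℝ) →ᵃ[ℝ] ℝ) (τ : J → SignType) {q : (ι → ℝ) → ℝ}
    (hq : q ∈ polyFun (ι → ℝ)) (hint : IntegrableOn q (signCell g τ)) (y : ι) :
    ∃ E : Set ℝ, E.Finite ∧
      (∀ t ∉ E, Integrable fun z => (signCell g τ).indicator q (glue y t z)) ∧
      HasPolyPieces fun t => ∫ z, (signCell g τ).indicator q (glue y t z) := by
  by_cases h : ∀ j, τ j = 0 → g j = 0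
  · obtain ⟨A, hA, hSA⟩ := exists_signCell_eq_pos h
    refine ⟨∅, Set.finite_empty, ?_⟩
    by_cases hb : Bornology.IsBounded (signCell g τ)
    · have hb' : ∀ t, Bornology.IsBounded {z | (t, z) ∈ glueMap y ⁻¹' signCell g τ} := by
        refine fun t => Bornology.forall_isBounded_image_eval_iff.1 fun i =>
          (Bornology.forall_isBounded_image_eval_iff.2 hb i).subset ?_
        rintro _ ⟨z, hz, rfl⟩
        exact ⟨glue y t z, hz, glue_apply_ne y t z i⟩
      have hS := (isPolyhedral_signCell g τ).preimage (glueMap y)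
      have hr := comp_mem_polyFun hq (glueMap y)
      exact ⟨fun t _ => integrable_indicator_fiber hS (hb' t) hr,
        hasPolyPieces_of_mem_piecewisePoly (integral_fiber_mem_piecewisePoly hS hb' hr)⟩
    · have h0 : (signCell g τ).indicator q = 0 := by
        funext x
        by_cases hx : x ∈ signCell g τ
        · rw [Set.indicator_of_mem hx]
          rw [hSA] at hb hint hx
          exact eq_zero_of_integrableOn_unbounded hA hb hq hint x hx
        · exact Set.indicator_of_notMem hx _
      simp only [h0, Pi.zero_apply, integral_zero]
      exact ⟨fun _ _ => integrable_zero _ _ _, hasPolyPieces_zero⟩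
  · push Not at h
    obtain ⟨j, hj, hgj⟩ := h
    have hfin := (subsingleton_vanishing_fibers y hgj).finite
    have hae : ∀ t ∉ {t | ∀ z, g j (glue y t z) = 0},
        (fun z => (signCell g τ).indicator q (glue y t z)) =ᵐ[volume] 0 := by
      intro t ht
      simp only [Set.mem_ofPred_eq, not_forall] at ht
      have hnull := volume_zeros_eq_zero (g := ((g j).comp (glueMap y)).comp (fiberMap t)) ht
      filter_upwards [measure_eq_zero_iff_ae_notMem.1 hnull] with z hz
      refine Set.indicator_of_notMem (fun hmem => hz ?_) _
      have := hmem j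
      rwa [hj, sign_eq_zero_iff] at this
    refine ⟨_, hfin, fun t ht => (integrable_zero _ _ _).congr (hae t ht).symm,
      hasPolyPieces_zero.congr_off_finite hfin fun t ht => ?_⟩
    simpa using integral_congr_ae (hae t ht)

/-- An integrable function that is polynomial on each cell of an arrangement is integrable on all
but finitely many of the fibres `y = t`, and its fibre integral is piecewise polynomial in `t`. -/
lemma exists_finite_fiber_of_cellwise (g : J → (ι → ℝ) →ᵃ[ℝ] ℝ) {f : (ι → ℝ) → ℝ}
    (hf : ∀ τ, ∃ q ∈ polyFun (ι → ℝ), ∀ x ∈ signCell g τ, f x = q x) (hint : Integrable f) (y : ι) :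
    ∃ E : Set ℝ, E.Finite ∧ (∀ t ∉ E, Integrable fun z => f (glue y t z)) ∧
      HasPolyPieces fun t => ∫ z, f (glue y t z) := by
  choose q hq hfq using hf
  have hint' : ∀ τ, IntegrableOn (q τ) (signCell g τ) := fun τ =>
    (hint.integrableOn (s := signCell g τ)).congr_fun (hfq τ)
      (isPolyhedral_signCell g τ).measurableSet
  choose E hE hEint hEpoly using fun τ => exists_finite_fiber_signCell g τ (hq τ) (hint' τ) y
  have := Fintype.ofFinite (J → SignType)
  have hsum : ∀ x, f x = ∑ τ, (signCell g τ).indicator (q τ) x := by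
    intro x
    have hx : x ∈ signCell g (fun j => SignType.sign (g j x)) := fun j => rfl
    rw [Finset.sum_eq_single fun j => SignType.sign (g j x), Set.indicator_of_mem hx, hfq _ x hx]
    · intro τ _ hτ
      exact Set.indicator_of_notMem (fun h => hτ (funext fun j => (h j).symm)) _
    · simp
  have hF := Set.finite_iUnion hE
  have hEint' : ∀ t ∉ ⋃ τ, E τ, ∀ τ, Integrable fun z =>
      (signCell g τ).indicator (q τ) (glue y t z) := fun t ht τ =>
    hEint τ t fun h => ht (Set.mem_iUnion.2 ⟨τ, h⟩)
  refine ⟨_, hF, fun t ht => ?_, (HasPolyPieces.sum Finset.univ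
    fun τ _ => hEpoly τ).congr_off_finite hF fun t ht => ?_⟩
  · simp_rw [hsum]
    exact integrable_finsetSum _ fun τ _ => hEint' t ht τ
  · simp_rw [hsum]
    rw [integral_finsetSum _ fun τ _ => hEint' t ht τ, Finset.sum_apply]

end Fibers

/-! ### The arrangement of a theory -/

section Theories

universe u v

variable {ι : Type u} {κ : Type v} [Fintype ι]

/-- A term as an affine function. -/
def LinTerm.toAffineMap (t : LinTerm ι) : (ι → ℝ) →ᵃ[ℝ] ℝ :=
  (∑ i, t.coeff i • LinearMap.proj (R := ℝ) (φ := fun _ : ι => ℝ) i).toAffineMap +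
    AffineMap.const ℝ _ t.const

lemma LinTerm.toAffineMap_apply (t : LinTerm ι) (x : ι → ℝ) : t.toAffineMap x = t.eval x := by
  simp [LinTerm.toAffineMap, LinTerm.eval]

/-- The differences of the terms that an atom compares. -/
def Atom.forms : Atom ι κ → List ((ι → ℝ) →ᵃ[ℝ] ℝ)
  | .bool _ => []
  | .cmp _ s t => [s.toAffineMap - t.toAffineMap]
  | .chain _ _ s t u => [s.toAffineMap - t.toAffineMap, t.toAffineMap - u.toAffineMap]

/-- The differences of the terms that the atom of a literal compares. -/
def Literal.forms : Literal ι κ → List ((ι → ℝ) →ᵃ[ℝ] ℝ)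
  | .pos A => A.forms
  | .neg A => A.forms

/-- The truth of a comparison depends only on the sign of the difference of the two sides. -/
lemma Cmp.holds_congr (r : Cmp) {a c a' c' : ℝ}
    (h : SignType.sign (a - c) = SignType.sign (a' - c')) : r.Holds a c ↔ r.Holds a' c' := by
  have hlt : a < c ↔ a' < c' := by
    rw [← sub_neg, ← sign_eq_neg_one_iff, h, sign_eq_neg_one_iff, sub_neg]
  have heq : a = c ↔ a' = c' := by
    rw [← sub_eq_zero, ← sign_eq_zero_iff, h, sign_eq_zero_iff, sub_eq_zero]
  cases r with
  | lt => exact hlt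
  | le => simp only [Cmp.Holds, le_iff_lt_or_eq, hlt, heq]
  | eq => exact heq

lemma Literal.holds_congr (l : Literal ι κ) (b : κ → Bool) {x x' : ι → ℝ}
    (h : ∀ g ∈ l.forms, SignType.sign (g x) = SignType.sign (g x')) :
    l.Holds x b ↔ l.Holds x' b := by
  have hA : ∀ A : Atom ι κ, (∀ g ∈ A.forms, SignType.sign (g x) = SignType.sign (g x')) →
      (A.Holds x b ↔ A.Holds x' b) := by
    intro A hA
    cases A with
    | bool a => exact Iff.rfl
    | cmp r s t =>
      simp only [Atom.forms, List.mem_singleton, forall_eq, AffineMap.coe_sub, Pi.sub_apply,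
        LinTerm.toAffineMap_apply] at hA
      exact r.holds_congr hA
    | chain r₁ r₂ s t u =>
      simp only [Atom.forms, List.mem_cons, List.not_mem_nil, or_false, forall_eq_or_imp, forall_eq,
        AffineMap.coe_sub, Pi.sub_apply, LinTerm.toAffineMap_apply] at hA
      exact and_congr (r₁.holds_congr hA.1) (r₂.holds_congr hA.2)
  cases l with
  | pos A => exact hA A h
  | neg A => exact not_congr (hA A h)

/-- The affine functions whose signs decide all literals of the theory and of the weight. -/
def allForms (θ : CNF ι κ) (L : Finset (Literal ι κ)) : List ((ι → ℝ) →ᵃ[ℝ] ℝ) :=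
  (θ.flatten ++ L.toList).flatMap Literal.forms

/-- The arrangement given by `allForms`. -/
def arrangement (θ : CNF ι κ) (L : Finset (Literal ι κ)) :
    {g // g ∈ allForms θ L} → (ι → ℝ) →ᵃ[ℝ] ℝ := Subtype.val

instance (θ : CNF ι κ) (L : Finset (Literal ι κ)) : Finite {g // g ∈ allForms θ L} :=
  List.finite_toSet (allForms θ L)

lemma sign_eq_of_mem_signCell {θ : CNF ι κ} {L : Finset (Literal ι κ)}
    {τ : {g // g ∈ allForms θ L} → SignType} {x x' : ι → ℝ}
    (hx : x ∈ signCell (arrangement θ L) τ) (hx' : x' ∈ signCell (arrangement θ L) τ)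
    {l : Literal ι κ} (hl : l ∈ θ.flatten ∨ l ∈ L) (b : κ → Bool) : l.Holds x b ↔ l.Holds x' b := by
  refine l.holds_congr b fun g hg => ?_
  have hmem : g ∈ allForms θ L :=
    List.mem_flatMap.2 ⟨l, by simpa only [List.mem_append, Finset.mem_toList] using hl, hg⟩
  exact (hx ⟨g, hmem⟩).trans (hx' ⟨g, hmem⟩).symm

lemma mem_solutions_congr {θ : CNF ι κ} {L : Finset (Literal ι κ)}
    {τ : {g // g ∈ allForms θ L} → SignType} {x x' : ι → ℝ}
    (hx : x ∈ signCell (arrangement θ L) τ) (hx' : x' ∈ signCell (arrangement θ L) τ)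
    (b : κ → Bool) : x ∈ θ.solutions b ↔ x' ∈ θ.solutions b := by
  refine forall₂_congr fun C hC => exists_congr fun l => and_congr_right fun hl => ?_
  exact sign_eq_of_mem_signCell hx hx' (Or.inl (List.mem_flatten.2 ⟨C, hC, hl⟩)) b

/-- Within a cell the truth of every literal is fixed, so that the weight restricted to the
solutions is either zero or one product of the polynomials `P l`. -/
lemma exists_polyFun_on_signCell (θ : CNF ι κ) (L : Finset (Literal ι κ))
    (P : Literal ι κ → MvPolynomial ι ℝ) (b : κ → Bool)
    (τ : {g // g ∈ allForms θ L} → SignType) :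
    ∃ q ∈ polyFun (ι → ℝ), ∀ x ∈ signCell (arrangement θ L) τ,
      (θ.solutions b).indicator (fun x => weight L P x b) x = q x := by
  classical
  by_cases h : ∃ x₀ ∈ signCell (arrangement θ L) τ, x₀ ∈ θ.solutions b
  · obtain ⟨x₀, hx₀, hsol⟩ := h
    refine ⟨_, eval_mem_polyFun (∏ l ∈ L with l.Holds x₀ b, P l), fun x hx => ?_⟩
    rw [Set.indicator_of_mem ((mem_solutions_congr hx hx₀ b).2 hsol), map_prod, weight]
    refine Finset.prod_congr ?_ fun _ _ => rfl
    ext l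
    simp only [Finset.mem_filter]
    exact and_congr_right fun hl => sign_eq_of_mem_signCell hx hx₀ (Or.inr hl) b
  · push Not at h
    exact ⟨0, zero_mem _, fun x hx => Set.indicator_of_notMem (h x hx) _⟩

/-- The solution set under a truth assignment is a finite union of polyhedral sets. -/
lemma exists_solutions_eq_iUnion (θ : CNF ι κ) (b : κ → Bool) :
    ∃ (α : Type u) (_ : Finite α) (C : α → Set (ι → ℝ)),
      (∀ a, IsPolyhedral (C a)) ∧ θ.solutions b = ⋃ a, C a := by
  refine ⟨{τ // ∃ x ∈ signCell (arrangement (κ := κ) θ ∅) τ, x ∈ θ.solutions b}, inferInstance,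
    fun τ => signCell (arrangement θ ∅) τ, fun τ => isPolyhedral_signCell _ _, ?_⟩
  ext x
  simp only [Set.mem_iUnion]
  constructor
  · exact fun hx =>
      ⟨⟨fun g => SignType.sign (arrangement θ ∅ g x), x, fun _ => rfl, hx⟩, fun _ => rfl⟩
  · rintro ⟨⟨τ, x', hx', hsol⟩, hx⟩
    exact (mem_solutions_congr hx hx' b).2 hsol

lemma measurableSet_solutions (θ : CNF ι κ) (b : κ → Bool) : MeasurableSet (θ.solutions b) := by
  obtain ⟨α, _, C, hC, h⟩ := exists_solutions_eq_iUnion θ b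
  rw [h]
  exact MeasurableSet.iUnion fun a => (hC a).measurableSet

variable [DecidableEq ι]

lemma measurableSet_fiber (θ : CNF ι κ) (y : ι) (t : ℝ) (b : κ → Bool) :
    MeasurableSet (θ.fiber y t b) :=
  ((measurePreserving_glue y).measurable.comp measurable_prodMk_left)
    (measurableSet_solutions θ b)

/-- The projection of the solution set is a finite union of intervals, the projections of the convex
cells that make up the solution set. -/
lemma exists_projection_eq_iUnion [Finite κ] (θ : CNF ι κ) (y : ι) :
    ∃ (α : Type (max u v)) (_ : Finite α) (I : α → Set ℝ),
      (∀ a, (I a).OrdConnected) ∧ θ.projection y = ⋃ a, I a := by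
  choose α hα C hC h using exists_solutions_eq_iUnion θ
  refine ⟨Σ b, α b, inferInstance, fun a => (fun x => x y) '' C a.1 a.2, fun a => ?_, ?_⟩
  · exact ((hC a.1 a.2).convex.linear_image
      (LinearMap.proj (R := ℝ) (φ := fun _ : ι => ℝ) y)).ordConnected
  · ext t
    simp only [Set.mem_iUnion, Sigma.exists, Set.mem_image]
    constructor
    · rintro ⟨z, b, hz⟩
      have hz' : glue y t z ∈ θ.solutions b := hz
      rw [h b, Set.mem_iUnion] at hz'
      obtain ⟨a, ha⟩ := hz'
      exact ⟨b, a, _, ha, glue_apply_self y t z⟩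
    · rintro ⟨b, a, x, hx, rfl⟩
      refine ⟨fun i => x i, b, ?_⟩
      rw [glue_self]
      have : x ∈ θ.solutions b := by
        rw [h b]
        exact Set.mem_iUnion.2 ⟨a, hx⟩
      exact this

end Theories

end SMTLRA

end

open SMTLRA MeasureTheory in
theorem mainTheorem3 {ι κ : Type*} [Fintype ι] [DecidableEq ι] [Fintype κ] [DecidableEq κ]
    (θ : SMTLRA.CNF ι κ) (hθ : θ.primalGraph.IsAcyclic)
    (L : Finset (SMTLRA.Literal ι κ)) (P : SMTLRA.Literal ι κ → MvPolynomial ι ℝ)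
    (hint : ∀ b : κ → Bool, MeasureTheory.IntegrableOn (fun x => SMTLRA.weight L P x b)
      (θ.solutions b))
    (y : ι) :
    {t : ℝ | ¬ ∀ b : κ → Bool, MeasureTheory.IntegrableOn
        (fun z => SMTLRA.weight L P (SMTLRA.glue y t z) b) (θ.fiber y t b)}.Finite ∧
    SMTLRA.IsPiecewisePolynomialOn (SMTLRA.fiberIntegral θ (SMTLRA.weight L P) y)
      (θ.projection y) ∧
    MeasureTheory.IntegrableOn (SMTLRA.fiberIntegral θ (SMTLRA.weight L P) y) (θ.projection y) ∧
    SMTLRA.WMI θ (SMTLRA.weight L P) =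
      ∫ t in θ.projection y, SMTLRA.fiberIntegral θ (SMTLRA.weight L P) y t := by
  -- `f b` is the weight, extended by zero off the solutions.
  let f : (κ → Bool) → (ι → ℝ) → ℝ := fun b =>
    (θ.solutions b).indicator fun x => weight L P x b
  have hf : ∀ b, Integrable (f b) := fun b =>
    (integrable_indicator_iff (measurableSet_solutions θ b)).2 (hint b)
  choose E hE hEint hEpoly using fun b =>
    exists_finite_fiber_of_cellwise (arrangement θ L) (exists_polyFun_on_signCell θ L P b) (hf b) y
  have hfiber : ∀ b t, (fun z => f b (glue y t z)) =
      (θ.fiber y t b).indicator fun z => weight L P (glue y t z) b := fun b t => rfl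
  have hp : fiberIntegral θ (weight L P) y = ∑ b, fun t => ∫ z, f b (glue y t z) := by
    funext t
    rw [Finset.sum_apply]
    refine Finset.sum_congr rfl fun b _ => ?_
    rw [hfiber, integral_indicator (measurableSet_fiber θ y t b)]
  obtain ⟨α, _, I, hI, hproj⟩ := exists_projection_eq_iUnion θ y
  have hfg : ∀ b, Integrable (fun p : ℝ × ({i : ι // i ≠ y} → ℝ) => f b (glue y p.1 p.2))
      (volume.prod volume) := fun b =>
    (measurePreserving_glue y).integrable_comp_of_integrable (hf b)
  have hpint : Integrable (fiberIntegral θ (weight L P) y) := by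
    rw [hp]
    exact integrable_finsetSum' _ fun b _ => (hfg b).integral_prod_left
  have hzero : ∀ t ∉ θ.projection y, fiberIntegral θ (weight L P) y t = 0 := by
    intro t ht
    refine Finset.sum_eq_zero fun b _ => ?_
    have : θ.fiber y t b = ∅ := Set.eq_empty_of_forall_notMem fun z hz => ht ⟨z, b, hz⟩
    rw [this, setIntegral_empty]
  refine ⟨(Set.finite_iUnion hE).subset fun t ht => ?_, ?_, hpint.integrableOn, ?_⟩
  · by_contra hmem
    refine ht fun b => ?_
    rw [← integrable_indicator_iff (measurableSet_fiber θ y t b), ← hfiber]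
    exact hEint b t fun h => hmem (Set.mem_iUnion.2 ⟨b, h⟩)
  · rw [hproj, hp]
    exact (HasPolyPieces.sum _ fun b _ => hEpoly b).isPiecewisePolynomialOn hI
  · rw [setIntegral_eq_integral_of_forall_compl_eq_zero hzero, hp]
    simp only [Finset.sum_apply]
    rw [integral_finsetSum _ fun b _ => (hfg b).integral_prod_left]
    refine Finset.sum_congr rfl fun b _ => ?_
    rw [← integral_indicator (measurableSet_solutions θ b), ← integral_prod _ (hfg b)]
    exact ((measurePreserving_glue y).integral_comp (measurableEmbedding_glue y) (f b)).symm
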